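/- **Setting.** Let $E,J,R\in\mathbb C^{n\times n}$ and $B\in\mathbb C^{n\times m}$ with $E=E^H\ge 0$, $R=R^H\ge 0$ (positive semidefinite) and $J=-J^H$; they are the coefficients of the port-Hamiltonian descriptor system $E\dot x=(J-R)x+Bu$, $y=B^Hx$. Let $\mathcal S_\infty(E)$ be any matrix of full column rank whose columns span the right nullspace of $E$. A square pencil $\lambda E-A$ is *regular* if $\det(\lambda_0E-A)\neq0$ for some $\lambda_0\in\mathbb C$. A number $\lambda_0\in\mathbb C$ is a *finite eigenvalue* of the pencil if $\operatorname{rank}(\lambda_0E-A)<\max_{\alpha\in\mathbb C}\operatorname{rank}(\alpha E-A)$. The *index* of a regular pencil is the size of the largest block $\lambda N-I$, with $N$ a nilpotent Jordan block, in its Kronecker canonical form, and it is $0$ if $E$ is invertible. **Theorem.** The following two assertions are equivalent. 1. There exist $F_S=-F_S^H$ and $F_H=F_H^H$ in $\mathbb C^{m\times m}$ such that $R+BF_HB^H\ge0$ and the pencil $\lambda E-\bigl(J+BF_SB^H-(R+BF_HB^H)\bigr)$ is regular, has index at most one, and has all its finite eigenvalues in the open left half plane $\{\lambda\in\mathbb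 C:\operatorname{Re}\lambda<0\}$. 2. One has $$\operatorname{rank}\begin{bmatrix}E&(J-R)\,\mathcal S_\infty(E)&B\end{bmatrix}=n,$$ and $$\operatorname{rank}\begin{bmatrix}J-R-sE&B\end{bmatrix}=n\quad\text{for all } s\in\mathbb C \text{ with } \operatorname{Re}s=0 \text{ (including } s=0\text{)}.$$ -/

import Mathlib

open scoped Matrix ComplexOrder

namespace PHDAE

/-- The square pencil `lam * E - A` is regular: `det (lam * E - A)` is nonzero for some complex
`lam`. -/
def IsRegularPencil {n : ℕ} (E A : Matrix (Fin n) (Fin n) ℂ) : Prop :=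
  ∃ lam : ℂ, (lam • E - A).det ≠ 0

/-- `lam` is a finite eigenvalue of the pencil `(E, A)`: the rank of `lam * E - A` is smaller than
the maximum over all complex `alpha` of the rank of `alpha * E - A`. -/
def IsFiniteEigenvalue {n : ℕ} (E A : Matrix (Fin n) (Fin n) ℂ) (lam : ℂ) : Prop :=
  ∃ alpha : ℂ, (lam • E - A).rank < (alpha • E - A).rank

/-- The `k × k` nilpotent Jordan block, with ones on the first superdiagonal and zeros elsewhere. -/
def nilpotentBlock (k : ℕ) : Matrix (Fin k) (Fin k) ℂ :=
  Matrix.of fun i j => if (i : ℕ) + 1 = (j : ℕ) then 1 else 0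

/-- The regular pencil `lam * E - A` has index `nu`: it is strictly equivalent to
`diag (lam * I - C, lam * N₁ - I, …, lam * Nₛ - I)`, where `N₁, …, Nₛ` are nilpotent Jordan blocks
of positive sizes, and `nu` is the size of the largest of these blocks (`nu = 0` if there is no such
block, that is, if `E` is invertible).  The finite part `C` need not be in Jordan form, as this does
not affect the blocks `Nⱼ`. -/
def HasIndex {n : ℕ} (E A : Matrix (Fin n) (Fin n) ℂ) (nu : ℕ) : Prop :=
  ∃ (S T : Matrix (Fin n) (Fin n) ℂ) (r s : ℕ) (sigma : Fin s → ℕ)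
    (e : Fin n ≃ Fin r ⊕ (Σ j : Fin s, Fin (sigma j))) (C : Matrix (Fin r) (Fin r) ℂ),
    IsUnit S.det ∧ IsUnit T.det ∧ (∀ j, 0 < sigma j) ∧
    S * E * T = (Matrix.fromBlocks (1 : Matrix (Fin r) (Fin r) ℂ) 0 0
      (Matrix.blockDiagonal' fun j => nilpotentBlock (sigma j))).submatrix e e ∧
    S * A * T = (Matrix.fromBlocks C 0 0
      (1 : Matrix (Σ j : Fin s, Fin (sigma j)) (Σ j : Fin s, Fin (sigma j)) ℂ)).submatrix e e ∧
    nu = Finset.univ.sup sigma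

/-- The columns of `S` form a basis of the right nullspace of `M`: `S` has full column rank and its
columns span the nullspace. -/
def IsRightNullspaceBasis {n k : ℕ} (M : Matrix (Fin n) (Fin n) ℂ)
    (S : Matrix (Fin n) (Fin k) ℂ) : Prop :=
  LinearIndependent ℂ S.col ∧
    Submodule.span ℂ (Set.range S.col) = LinearMap.ker M.mulVecLin

/-- The coefficients of a port-Hamiltonian descriptor system
`E x' = (J - R) x + B u`, `y = Bᴴ x`, where `B` is arbitrary. -/
structure System (n m : ℕ) where
  E : Matrix (Fin n) (Fin n) ℂ
  J : Matrix (Fin n) (Fin n) ℂ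
  R : Matrix (Fin n) (Fin n) ℂ
  B : Matrix (Fin n) (Fin m) ℂ
  E_posSemidef : E.PosSemidef
  J_skewHermitian : Jᴴ = -J
  R_posSemidef : R.PosSemidef

/-- The state matrix of the closed loop obtained with the proportional output feedback
`u = (FS - FH) y + v`. -/
def System.closedLoop {n m : ℕ} (P : System n m) (FS FH : Matrix (Fin m) (Fin m) ℂ) :
    Matrix (Fin n) (Fin n) ℂ :=
  P.J + P.B * FS * P.Bᴴ - (P.R + P.B * FH * P.Bᴴ)

/-- The stabilization problem by proportional output feedback is solvable. -/
def System.IsStabilizable {n m : ℕ} (P : System n m) : Prop :=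
  ∃ FS FH : Matrix (Fin m) (Fin m) ℂ,
    FSᴴ = -FS ∧ FHᴴ = FH ∧
    (P.R + P.B * FH * P.Bᴴ).PosSemidef ∧
    IsRegularPencil P.E (P.closedLoop FS FH) ∧
    (∃ nu : ℕ, nu ≤ 1 ∧ HasIndex P.E (P.closedLoop FS FH) nu) ∧
    ∀ lam : ℂ, IsFiniteEigenvalue P.E (P.closedLoop FS FH) lam → lam.re < 0

end PHDAE

/-! Full row rank means that no nonzero row `w` annihilates the block matrix. If `w B = 0`, feedback
leaves `w (J - R)` unchanged, so such a `w` survives in every closed loop, contradicting index at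
most one or the absence of imaginary eigenvalues. This gives necessity. For sufficiency take `FS =
0`, `FH = 1`, so `A = J - (R + B Bᴴ)`. If `Re (vᴴ A v) ≥ 0`, positivity forces `R v = 0` and `Bᴴ v =
0`, and skewness of `J` turns `v` into a left annihilator `vᴴ` (`annihilates_of_re_nonneg`). This
applies to eigenvectors with `Re lam ≥ 0`, and to `v ∈ ker E` with `A v ∈ range E`; the rank
conditions then give `v = 0`. In the second case a dimension count makes `ker E` and `A⁻¹ (range E)`
complementary, which yields the canonical form of index at most one. -/

namespace PHDAE

open Matrix Module

/-! ### Row annihilators and semidefinite quadratic forms. -/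

/-- A matrix has full row rank iff its left nullspace is trivial. -/
theorem rank_eq_iff_forall_vecMul {n : ℕ} {ι : Type*} [Fintype ι] (M : Matrix (Fin n) ι ℂ) :
    M.rank = n ↔ ∀ w : Fin n → ℂ, w ᵥ* M = 0 → w = 0 := by
  have h : LinearIndependent ℂ M.row ↔ ∀ w : Fin n → ℂ, w ᵥ* M = 0 → w = 0 := by
    rw [← vecMul_injective_iff]
    exact injective_iff_map_eq_zero M.vecMulLinear
  rw [← h, linearIndependent_iff_card_eq_finrank_span, Fintype.card_fin,
    rank_eq_finrank_span_row]
  exact eq_comm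

theorem rank_eq_of_det_ne_zero {n : ℕ} {M : Matrix (Fin n) (Fin n) ℂ} (h : M.det ≠ 0) :
    M.rank = n := by
  simpa using rank_of_isUnit M ((isUnit_iff_isUnit_det M).2 (isUnit_iff_ne_zero.2 h))

theorem star_vecMul_of_conjTranspose_mulVec_eq_zero {n : ℕ} {ι : Type*} [Fintype ι]
    {M : Matrix (Fin n) ι ℂ} {v : Fin n → ℂ} (h : Mᴴ *ᵥ v = 0) : star v ᵥ* M = 0 := by
  have := congrArg star h
  rwa [star_mulVec, conjTranspose_conjTranspose, star_zero] at this

/-- The quadratic form of a skew-Hermitian matrix is purely imaginary. -/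
theorem re_star_dotProduct_mulVec_of_skewHermitian {n : ℕ} {J : Matrix (Fin n) (Fin n) ℂ}
    (hJ : Jᴴ = -J) (v : Fin n → ℂ) : (star v ⬝ᵥ J *ᵥ v).re = 0 := by
  have h : star (star v ⬝ᵥ J *ᵥ v) = -(star v ⬝ᵥ J *ᵥ v) := by
    rw [← star_dotProduct, star_mulVec, ← dotProduct_mulVec, hJ]
    simp [neg_mulVec]
  have := congrArg Complex.re h
  simp at this
  linarith

/-- If `star v * (J - Q) * v` has nonnegative real part, with `J` skew-Hermitian and `Q ≥ 0`, then
`Q v = 0`. -/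
theorem mulVec_eq_zero_of_re_nonneg {n : ℕ} {J Q : Matrix (Fin n) (Fin n) ℂ} (hJ : Jᴴ = -J)
    (hQ : Q.PosSemidef) {v : Fin n → ℂ} (h : 0 ≤ (star v ⬝ᵥ (J - Q) *ᵥ v).re) :
    Q *ᵥ v = 0 := by
  rw [← hQ.dotProduct_mulVec_zero_iff]
  rw [sub_mulVec, dotProduct_sub, Complex.sub_re,
    re_star_dotProduct_mulVec_of_skewHermitian hJ] at h
  have h0 := Complex.nonneg_iff.1 (hQ.dotProduct_mulVec_nonneg v)
  exact Complex.ext (by simp; linarith [h0.1]) h0.2.symm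

/-- Sums of positive semidefinite matrices vanish only where both summands do. -/
theorem mulVec_eq_zero_of_add_mul_conjTranspose {n m : ℕ} {R : Matrix (Fin n) (Fin n) ℂ}
    {B : Matrix (Fin n) (Fin m) ℂ} (hR : R.PosSemidef) {v : Fin n → ℂ}
    (h : (R + B * Bᴴ) *ᵥ v = 0) : R *ᵥ v = 0 ∧ Bᴴ *ᵥ v = 0 := by
  have hB := posSemidef_self_mul_conjTranspose B
  have h0 : star v ⬝ᵥ R *ᵥ v + star v ⬝ᵥ (B * Bᴴ) *ᵥ v = 0 := by
    rw [← dotProduct_add, ← add_mulVec, h, dotProduct_zero]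
  obtain ⟨h1, h2⟩ := (add_eq_zero_iff_of_nonneg (hR.dotProduct_mulVec_nonneg v)
    (hB.dotProduct_mulVec_nonneg v)).1 h0
  rw [hR.dotProduct_mulVec_zero_iff] at h1
  rw [hB.dotProduct_mulVec_zero_iff] at h2
  exact ⟨h1, (self_mul_conjTranspose_mulVec_eq_zero B v).1 h2⟩

/-! ### Pencils of index at most one. -/

theorem nilpotentBlock_one : nilpotentBlock 1 = 0 := by
  ext i j
  simp [nilpotentBlock]

/-- A basis in which, up to an invertible `G`, the pencil is `diag (lam * I - C, -I)` shows that
the index is at most one. -/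
theorem hasIndex_of_basis {n r s : ℕ} {E A : Matrix (Fin n) (Fin n) ℂ} {sigma : Fin s → ℕ}
    (hsigma : ∀ j, sigma j = 1) (c : Basis (Fin r ⊕ Σ j : Fin s, Fin (sigma j)) ℂ (Fin n → ℂ))
    (G : (Fin n → ℂ) ≃ₗ[ℂ] (Fin n → ℂ))
    (hEl : ∀ i, G (E *ᵥ c (Sum.inl i)) = c (Sum.inl i)) (hEr : ∀ j, E *ᵥ c (Sum.inr j) = 0)
    (hAl : ∀ i j, c.repr (G (A *ᵥ c (Sum.inl i))) (Sum.inr j) = 0)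
    (hAr : ∀ j, G (A *ᵥ c (Sum.inr j)) = c (Sum.inr j)) :
    HasIndex E A (Finset.univ.sup sigma) := by
  obtain rfl : sigma = fun _ => 1 := funext hsigma
  let b := Pi.basisFun ℂ (Fin n)
  let e := b.indexEquiv c
  let c' := c.reindex e.symm
  -- Both canonical blocks are read off from the matrices of `G ∘ E` and `G ∘ A` in the basis `c'`.
  have key : ∀ M : Matrix (Fin n) (Fin n) ℂ,
      LinearMap.toMatrix b c' G.toLinearMap * M * b.toMatrix c' =
        LinearMap.toMatrix c' c' (G.toLinearMap ∘ₗ M.mulVecLin) := fun M => by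
    have hM : M = LinearMap.toMatrix b b M.mulVecLin :=
      (LinearMap.toMatrix'_toLin' M).symm
    conv_lhs => rw [hM]
    rw [← LinearMap.toMatrix_comp, ← LinearMap.toMatrix_id_eq_basis_toMatrix,
      ← LinearMap.toMatrix_comp, LinearMap.comp_id]
  have entry : ∀ (M : Matrix (Fin n) (Fin n) ℂ) i j,
      (LinearMap.toMatrix b c' G.toLinearMap * M * b.toMatrix c') i j =
        c.repr (G (M *ᵥ c (e j))) (e i) := fun M i j => by
    rw [key, LinearMap.toMatrix_apply, Basis.reindex_apply, Basis.repr_reindex_apply,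
      Equiv.symm_symm]
    rfl
  have hself : ∀ i j, c.repr (c j) i = if i = j then 1 else 0 := fun i j => by
    rw [c.repr_self, Finsupp.single_apply]
    simp only [eq_comm]
  refine ⟨LinearMap.toMatrix b c' G.toLinearMap, b.toMatrix c', r, s, fun _ => 1, e,
    Matrix.of fun i j => c.repr (G (A *ᵥ c (Sum.inl j))) (Sum.inl i),
    LinearEquiv.isUnit_det G b c', ?_, fun _ => one_pos, ?_, ?_, rfl⟩
  · rw [← isUnit_iff_isUnit_det]
    exact IsUnit.of_mul_eq_one_right _ (c'.toMatrix_mul_toMatrix_flip b)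
  · have hN : (blockDiagonal' fun _ : Fin s => nilpotentBlock 1) = 0 := by
      simp only [nilpotentBlock_one]
      exact blockDiagonal'_zero
    ext i j
    rw [entry, submatrix_apply, hN]
    generalize e i = i
    generalize e j = j
    rcases j with j | j
    · rw [hEl, hself]
      rcases i with i | i <;> simp [one_apply]
    · rw [hEr, map_zero, map_zero]
      rcases i with i | i <;> simp
  · ext i j
    rw [entry, submatrix_apply]
    generalize e i = i
    generalize e j = j
    rcases j with j | j
    · rcases i with i | i
      · simp
      · simp [hAl]
    · rw [hAr, hself]
      rcases i with i | i <;> simp [one_apply]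

/-- A pencil whose nullspace `ker E` is complementary to `A⁻¹ (range E)` has index at most one. -/
theorem hasIndex_of_isCompl {n : ℕ} (E A : Matrix (Fin n) (Fin n) ℂ)
    (h : IsCompl ((LinearMap.range E.mulVecLin).comap A.mulVecLin)
      (LinearMap.ker E.mulVecLin)) :
    ∃ nu ≤ 1, HasIndex E A nu := by
  set Y := (LinearMap.range E.mulVecLin).comap A.mulVecLin with hY
  set X := LinearMap.ker E.mulVecLin with hX
  -- `g` acts as `E` on `Y` and as `A` on `X`; its inverse normalizes both diagonal blocks to the
  -- identity.
  let g : (Fin n → ℂ) →ₗ[ℂ] (Fin n → ℂ) :=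
    E.mulVecLin + A.mulVecLin ∘ₗ X.subtype ∘ₗ X.projectionOnto Y h.symm
  have gX : ∀ x ∈ X, g x = A *ᵥ x := fun x hx => by
    have h1 : X.projectionOnto Y h.symm x = ⟨x, hx⟩ :=
      Submodule.projectionOnto_apply_left h.symm ⟨x, hx⟩
    have h2 : E *ᵥ x = 0 := hx
    simp [g, h1, h2]
  have gY : ∀ y ∈ Y, g y = E *ᵥ y := fun y hy => by
    have h1 : X.projectionOnto Y h.symm y = 0 :=
      Submodule.projectionOnto_apply_right h.symm ⟨y, hy⟩
    simp [g, h1]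
  have dec : ∀ v, ∃ y ∈ Y, ∃ x ∈ X, y + x = v := fun v =>
    Submodule.mem_sup.1 (h.sup_eq_top ▸ Submodule.mem_top)
  have dis : ∀ v, v ∈ Y → v ∈ X → v = 0 := fun v hy hx =>
    Submodule.disjoint_def.1 h.disjoint v hy hx
  have ginj : Function.Injective g := by
    rw [injective_iff_map_eq_zero]
    intro v hv
    obtain ⟨y, hy, x, hx, rfl⟩ := dec v
    rw [map_add, gX x hx, gY y hy] at hv
    have hx0 : x = 0 := by
      refine dis x ⟨-y, ?_⟩ hx
      simp only [mulVecLin_apply, mulVec_neg]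
      exact neg_eq_of_add_eq_zero_right hv
    subst hx0
    simp only [mulVec_zero, add_zero] at hv ⊢
    exact dis y hy hv
  let G : (Fin n → ℂ) ≃ₗ[ℂ] (Fin n → ℂ) := LinearEquiv.ofInjectiveEndo g ginj
  have hG : ∀ v, G v = g v := fun v => rfl
  have GE : ∀ y ∈ Y, G.symm (E *ᵥ y) = y := fun y hy => by
    rw [G.symm_apply_eq, hG, gY y hy]
  have GA : ∀ x ∈ X, G.symm (A *ᵥ x) = x := fun x hx => by
    rw [G.symm_apply_eq, hG, gX x hx]
  -- `A y = E u`, and only the `Y`-component of `u` contributes to `E u`.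
  have GAY : ∀ y ∈ Y, G.symm (A *ᵥ y) ∈ Y := fun y hy => by
    obtain ⟨u, hu⟩ := hy
    obtain ⟨y', hy', x, hx, rfl⟩ := dec u
    have hx0 : E *ᵥ x = 0 := hx
    simp only [mulVecLin_apply, mulVec_add, hx0, add_zero] at hu
    rw [← hu, GE y' hy']
    exact hy'
  let k := finrank ℂ X
  let sigma : Fin k → ℕ := fun _ => 1
  let bY : Basis (Fin (finrank ℂ Y)) ℂ Y := finBasis ℂ Y
  let bX : Basis (Σ j : Fin k, Fin (sigma j)) ℂ X :=
    (finBasis ℂ X).reindex (Equiv.sigmaUnique (Fin k) fun _ => Fin 1).symm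
  let c := (bY.prod bX).map (Submodule.prodEquivOfIsCompl Y X h)
  have cl : ∀ i, c (Sum.inl i) = bY i := fun i => by simp [c]
  have cr : ∀ i, c (Sum.inr i) = bX i := fun i => by simp [c]
  have cY : ∀ v ∈ Y, ∀ i, c.repr v (Sum.inr i) = 0 := fun v hv i => by
    have h1 : (Submodule.prodEquivOfIsCompl Y X h).symm v = (⟨v, hv⟩, 0) :=
      Submodule.prodEquivOfIsCompl_symm_apply_left Y X h ⟨v, hv⟩
    simp [c, h1]
  -- The supremum is `0` when `ker E` is trivial, and `1` otherwise.
  refine ⟨_, Finset.sup_le fun _ _ => le_rfl,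
    hasIndex_of_basis (sigma := sigma) (fun _ => rfl) c G.symm (fun i => ?_) (fun j => ?_)
      (fun i j => ?_) (fun j => ?_)⟩
  · rw [cl, GE _ (bY i).2]
  · rw [cr]
    exact (bX j).2
  · rw [cl]
    exact cY _ (GAY _ (bY i).2) j
  · rw [cr, GA _ (bX j).2]

/-- For a pencil of index at most one, only the zero vector is a left annihilator of both `E` and
`A (ker E)`. -/
theorem HasIndex.eq_zero_of_vecMul {n : ℕ} {E A : Matrix (Fin n) (Fin n) ℂ} {nu : ℕ}
    (h : HasIndex E A nu) (hnu : nu ≤ 1) {w : Fin n → ℂ} (hE : w ᵥ* E = 0)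
    (hA : ∀ v, E *ᵥ v = 0 → w ⬝ᵥ A *ᵥ v = 0) : w = 0 := by
  obtain ⟨S, T, r, s, sigma, e, C, hS, -, hpos, hSE, hSA, rfl⟩ := h
  have hone : ∀ j, sigma j = 1 := fun j =>
    le_antisymm ((Finset.le_sup (Finset.mem_univ j)).trans hnu) (hpos j)
  obtain rfl : sigma = fun _ => 1 := funext hone
  have hN : (blockDiagonal' fun _ : Fin s => nilpotentBlock 1) = 0 := by
    simp only [nilpotentBlock_one]
    exact blockDiagonal'_zero
  rw [hN] at hSE
  set u := w ᵥ* S⁻¹ with hu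
  have hw : u ᵥ* S = w := by rw [hu, vecMul_vecMul, nonsing_inv_mul S hS, vecMul_one]
  have hET : u ᵥ* (S * E * T) = 0 := by
    rw [← vecMul_vecMul, ← vecMul_vecMul, hw, hE, zero_vecMul]
  have hu1 : ∀ i, u (e.symm (Sum.inl i)) = 0 := fun i => by
    have := congrFun hET (e.symm (Sum.inl i))
    rw [hSE] at this
    simp only [vecMul, dotProduct, submatrix_apply, Equiv.apply_symm_apply, Pi.zero_apply] at this
    rw [← e.symm.sum_comp] at this
    simpa [one_apply] using this
  -- As all nilpotent blocks vanish, these columns of `T` lie in `ker E`, where `hA` applies.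
  have hu2 : ∀ j, u (e.symm (Sum.inr j)) = 0 := fun j => by
    have hker : E *ᵥ (T *ᵥ Pi.single (e.symm (Sum.inr j)) 1) = 0 := by
      have : S *ᵥ (E *ᵥ (T *ᵥ Pi.single (e.symm (Sum.inr j)) 1)) = 0 := by
        rw [mulVec_mulVec, mulVec_mulVec, hSE, mulVec_single_one]
        ext i
        simp only [col_apply, submatrix_apply, Equiv.apply_symm_apply]
        rcases e i with i | i <;> simp
      exact eq_zero_of_mulVec_eq_zero hS.ne_zero this
    have := hA _ hker
    rw [← hw, ← dotProduct_mulVec, mulVec_mulVec, mulVec_mulVec, hSA, mulVec_single_one] at this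
    simp only [dotProduct, col_apply, submatrix_apply, Equiv.apply_symm_apply] at this
    rw [← e.symm.sum_comp] at this
    simpa [one_apply] using this
  have hu0 : u = 0 := by
    ext i
    obtain ⟨i, rfl⟩ := e.symm.surjective i
    rcases i with i | i
    · exact hu1 i
    · exact hu2 i
  rw [← hw, hu0, zero_vecMul]

/-- Removes the dependence on the chosen nullspace basis. -/
theorem vecMul_mul_eq_zero_iff {n k : ℕ} {E : Matrix (Fin n) (Fin n) ℂ}
    {S : Matrix (Fin n) (Fin k) ℂ} (hS : IsRightNullspaceBasis E S)
    (A : Matrix (Fin n) (Fin n) ℂ) (w : Fin n → ℂ) :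
    w ᵥ* (A * S) = 0 ↔ ∀ v, E *ᵥ v = 0 → w ⬝ᵥ A *ᵥ v = 0 := by
  have hr : LinearMap.range S.mulVecLin = LinearMap.ker E.mulVecLin := by
    rw [range_mulVecLin, hS.2]
  have hv : ∀ v, E *ᵥ v = 0 ↔ ∃ x, S *ᵥ x = v := fun v => by
    change v ∈ LinearMap.ker E.mulVecLin ↔ _
    rw [← hr]
    rfl
  constructor
  · intro h v hEv
    obtain ⟨x, rfl⟩ := (hv v).1 hEv
    rw [mulVec_mulVec, dotProduct_mulVec, h, zero_dotProduct]
  · intro h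
    refine dotProduct_eq_zero _ fun x => ?_
    rw [← dotProduct_mulVec, ← mulVec_mulVec]
    exact h _ ((hv _).2 ⟨x, rfl⟩)

theorem vecMul_fromCols_eq_zero_iff {n : ℕ} {ι κ : Type*} [Fintype ι] [Fintype κ]
    (M : Matrix (Fin n) ι ℂ) (N : Matrix (Fin n) κ ℂ) (w : Fin n → ℂ) :
    w ᵥ* fromCols M N = 0 ↔ w ᵥ* M = 0 ∧ w ᵥ* N = 0 := by
  rw [vecMul_fromCols]
  simp only [funext_iff, Sum.forall, Sum.elim_inl, Sum.elim_inr, Pi.zero_apply]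

/-! ### Closed loops of the port-Hamiltonian system. -/

namespace System

variable {n m : ℕ} (P : System n m)

theorem closedLoop_eq (FS FH : Matrix (Fin m) (Fin m) ℂ) :
    P.closedLoop FS FH = P.J - P.R + P.B * ((FS - FH) * P.Bᴴ) := by
  rw [closedLoop, Matrix.sub_mul, Matrix.mul_sub, Matrix.mul_assoc, Matrix.mul_assoc]
  abel

theorem vecMul_closedLoop (FS FH : Matrix (Fin m) (Fin m) ℂ) {w : Fin n → ℂ}
    (hB : w ᵥ* P.B = 0) : w ᵥ* P.closedLoop FS FH = w ᵥ* (P.J - P.R) := by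
  rw [closedLoop_eq, vecMul_add, ← vecMul_vecMul _ P.B, hB, zero_vecMul, add_zero]

theorem closedLoop_zero_one : P.closedLoop 0 1 = P.J - (P.R + P.B * P.Bᴴ) := by
  simp [closedLoop]

theorem posSemidef_add_mul_conjTranspose : (P.R + P.B * P.Bᴴ).PosSemidef :=
  P.R_posSemidef.add (posSemidef_self_mul_conjTranspose P.B)

/-- If the quadratic form of the closed loop with `FS = 0`, `FH = 1` has nonnegative real part at
`v`, then neither damping nor feedback acts on `v`. -/
theorem annihilates_of_re_nonneg {v : Fin n → ℂ}
    (h : 0 ≤ (star v ⬝ᵥ P.closedLoop 0 1 *ᵥ v).re) :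
    P.closedLoop 0 1 *ᵥ v = P.J *ᵥ v ∧ star v ᵥ* P.B = 0 ∧
      star v ᵥ* (P.J - P.R) = - star (P.J *ᵥ v) := by
  rw [closedLoop_zero_one] at h ⊢
  have hQ := mulVec_eq_zero_of_re_nonneg P.J_skewHermitian P.posSemidef_add_mul_conjTranspose h
  obtain ⟨hR, hB⟩ := mulVec_eq_zero_of_add_mul_conjTranspose P.R_posSemidef hQ
  have hR' : star v ᵥ* P.R = 0 := star_vecMul_of_conjTranspose_mulVec_eq_zero <| by
    rw [P.R_posSemidef.isHermitian.eq, hR]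
  refine ⟨by rw [sub_mulVec, hQ, sub_zero], star_vecMul_of_conjTranspose_mulVec_eq_zero hB, ?_⟩
  rw [vecMul_sub, hR', sub_zero, star_mulVec, P.J_skewHermitian,
    vecMul_neg, neg_neg]

theorem star_vecMul_E (v : Fin n → ℂ) : star v ᵥ* P.E = star (P.E *ᵥ v) := by
  rw [star_mulVec, P.E_posSemidef.isHermitian.eq]

/-- Under the rank condition on the imaginary axis, the closed loop with `FS = 0`, `FH = 1` has no
eigenvalue in the closed right half plane. -/
theorem eq_zero_of_mulVec_eq_zero
    (h : ∀ s : ℂ, s.re = 0 → (fromCols (P.J - P.R - s • P.E) P.B).rank = n)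
    {lam : ℂ} (hlam : 0 ≤ lam.re) {v : Fin n → ℂ}
    (hv : (lam • P.E - P.closedLoop 0 1) *ᵥ v = 0) : v = 0 := by
  have hA : P.closedLoop 0 1 *ᵥ v = lam • P.E *ᵥ v := by
    rw [sub_mulVec, smul_mulVec, sub_eq_zero] at hv
    exact hv.symm
  have hEv := Complex.nonneg_iff.1 (P.E_posSemidef.dotProduct_mulVec_nonneg v)
  have hre : (star v ⬝ᵥ P.closedLoop 0 1 *ᵥ v).re = lam.re * (star v ⬝ᵥ P.E *ᵥ v).re := by
    rw [hA, dotProduct_smul, smul_eq_mul, Complex.mul_re, ← hEv.2, mul_zero, sub_zero]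
  obtain ⟨h1, h2, h3⟩ := P.annihilates_of_re_nonneg (hre ▸ mul_nonneg hlam hEv.1)
  have hJ : P.J *ᵥ v = lam • P.E *ᵥ v := h1 ▸ hA
  -- If `Re lam > 0`, then `E v = 0`, so `s = 0` can replace `lam`.
  have hs : ∃ s : ℂ, s.re = 0 ∧ P.J *ᵥ v = s • P.E *ᵥ v := by
    by_cases h0 : lam.re = 0
    · exact ⟨lam, h0, hJ⟩
    · have h4 : lam.re * (star v ⬝ᵥ P.E *ᵥ v).re = 0 := by
        rw [← hre, h1, re_star_dotProduct_mulVec_of_skewHermitian P.J_skewHermitian]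
      have hE0 : P.E *ᵥ v = 0 := (P.E_posSemidef.dotProduct_mulVec_zero_iff v).1
        (Complex.ext ((mul_eq_zero.1 h4).resolve_left h0) hEv.2.symm)
      exact ⟨0, rfl, by rw [hJ, hE0, smul_zero, smul_zero]⟩
  obtain ⟨s, hs0, hs⟩ := hs
  have hconj : star s = -s := by
    apply Complex.ext <;> simp [hs0]
  have := (rank_eq_iff_forall_vecMul _).1 (h s hs0) (star v)
    ((vecMul_fromCols_eq_zero_iff _ _ _).2 ⟨?_, h2⟩)
  · exact star_eq_zero.1 this
  · rw [vecMul_sub, h3, vecMul_smul, star_vecMul_E, hs, star_smul, hconj, neg_smul, neg_neg,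
      sub_self]

/-- Under the rank condition at infinity, `ker E` meets `A⁻¹ (range E)` trivially, where `A` is the
closed loop with `FS = 0`, `FH = 1`. -/
theorem disjoint_comap_range_ker {k : ℕ} {S : Matrix (Fin n) (Fin k) ℂ}
    (hS : IsRightNullspaceBasis P.E S)
    (h : (fromCols P.E (fromCols ((P.J - P.R) * S) P.B)).rank = n) :
    Disjoint ((LinearMap.range P.E.mulVecLin).comap (P.closedLoop 0 1).mulVecLin)
      (LinearMap.ker P.E.mulVecLin) := by
  rw [Submodule.disjoint_def]
  rintro v ⟨u, hu⟩ hv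
  have hu' : P.closedLoop 0 1 *ᵥ v = P.E *ᵥ u := hu.symm
  have hE : P.E *ᵥ v = 0 := hv
  have hE' : star v ᵥ* P.E = 0 := by rw [star_vecMul_E, hE, star_zero]
  obtain ⟨h1, h2, h3⟩ := P.annihilates_of_re_nonneg (v := v) (by
    rw [hu', dotProduct_mulVec, hE', zero_dotProduct, Complex.zero_re])
  refine star_eq_zero.1 ((rank_eq_iff_forall_vecMul _).1 h (star v) ?_)
  rw [vecMul_fromCols_eq_zero_iff, vecMul_fromCols_eq_zero_iff, vecMul_mul_eq_zero_iff hS]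
  refine ⟨hE', fun x hx => ?_, h2⟩
  -- `vᴴ (J - R) x = -(E u)ᴴ x = -uᴴ E x = 0`.
  rw [dotProduct_mulVec, h3, ← h1, hu', ← star_vecMul_E, neg_dotProduct, ← dotProduct_mulVec, hx,
    dotProduct_zero, neg_zero]

/-- Invertibility of `A` preserves the dimension of `range E`, so rank-nullity makes the dimensions
add up to `n`. -/
theorem isCompl_comap_range_ker {E A : Matrix (Fin n) (Fin n) ℂ} (hA : A.det ≠ 0)
    (h : Disjoint ((LinearMap.range E.mulVecLin).comap A.mulVecLin)
      (LinearMap.ker E.mulVecLin)) :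
    IsCompl ((LinearMap.range E.mulVecLin).comap A.mulVecLin) (LinearMap.ker E.mulVecLin) := by
  have hinj : Function.Injective A.mulVecLin := by
    rw [injective_iff_map_eq_zero]
    exact fun v hv => Matrix.eq_zero_of_mulVec_eq_zero hA hv
  let f := LinearEquiv.ofInjectiveEndo A.mulVecLin hinj
  have hf : (LinearMap.range E.mulVecLin).comap A.mulVecLin =
      (LinearMap.range E.mulVecLin).map f.symm.toLinearMap :=
    Submodule.comap_equiv_eq_map_symm f _
  refine ⟨h, codisjoint_iff.2 (Submodule.eq_top_of_disjoint _ _ ?_ h)⟩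
  rw [hf, LinearEquiv.finrank_map_eq]
  exact E.mulVecLin.finrank_range_add_finrank_ker.ge

theorem isStabilizable_of_rank_eq {k : ℕ} {S : Matrix (Fin n) (Fin k) ℂ}
    (hS : IsRightNullspaceBasis P.E S)
    (h1 : (fromCols P.E (fromCols ((P.J - P.R) * S) P.B)).rank = n)
    (h2 : ∀ s : ℂ, s.re = 0 → (fromCols (P.J - P.R - s • P.E) P.B).rank = n) :
    P.IsStabilizable := by
  have hdet : ∀ lam : ℂ, 0 ≤ lam.re → (lam • P.E - P.closedLoop 0 1).det ≠ 0 :=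
    fun lam hlam h0 => by
      obtain ⟨v, hv, hv0⟩ := exists_mulVec_eq_zero_iff.2 h0
      exact hv (P.eq_zero_of_mulVec_eq_zero h2 hlam hv0)
  have hA : (P.closedLoop 0 1).det ≠ 0 := fun h0 => by
    obtain ⟨v, hv, hv0⟩ := exists_mulVec_eq_zero_iff.2 h0
    refine hv (P.eq_zero_of_mulVec_eq_zero h2 (lam := 0) le_rfl ?_)
    rw [zero_smul, zero_sub, neg_mulVec, hv0, neg_zero]
  refine ⟨0, 1, by simp, by simp, by simpa using P.posSemidef_add_mul_conjTranspose,
    ⟨0, hdet 0 le_rfl⟩,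
    hasIndex_of_isCompl _ _ (isCompl_comap_range_ker hA (P.disjoint_comap_range_ker hS h1)), ?_⟩
  rintro lam ⟨alpha, hlt⟩
  by_contra! hlam
  rw [rank_eq_of_det_ne_zero (hdet lam hlam)] at hlt
  exact hlt.not_ge (by simpa using rank_le_height (alpha • P.E - P.closedLoop 0 1))

theorem IsStabilizable.rank_eq {P : System n m} (h : P.IsStabilizable) {k : ℕ}
    {S : Matrix (Fin n) (Fin k) ℂ} (hS : IsRightNullspaceBasis P.E S) :
    (fromCols P.E (fromCols ((P.J - P.R) * S) P.B)).rank = n ∧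
      ∀ s : ℂ, s.re = 0 → (fromCols (P.J - P.R - s • P.E) P.B).rank = n := by
  obtain ⟨FS, FH, -, -, -, ⟨alpha, hreg⟩, ⟨nu, hnu, hidx⟩, hstab⟩ := h
  constructor
  · rw [rank_eq_iff_forall_vecMul]
    intro w hw
    rw [vecMul_fromCols_eq_zero_iff, vecMul_fromCols_eq_zero_iff, vecMul_mul_eq_zero_iff hS] at hw
    obtain ⟨hE, hA, hB⟩ := hw
    refine hidx.eq_zero_of_vecMul hnu hE fun v hv => ?_
    rw [dotProduct_mulVec, P.vecMul_closedLoop FS FH hB, ← dotProduct_mulVec]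
    exact hA v hv
  · intro s hs
    have hrank : (s • P.E - P.closedLoop FS FH).rank = n := by
      have hle : (s • P.E - P.closedLoop FS FH).rank ≤ n := by
        simpa using rank_le_height (s • P.E - P.closedLoop FS FH)
      -- Since rank `n` is attained at `alpha`, a rank drop at `s` would be a finite eigenvalue on
      -- the imaginary axis.
      refine hle.eq_of_not_lt fun hlt => ?_
      have := hstab s ⟨alpha, by rwa [rank_eq_of_det_ne_zero hreg]⟩
      linarith
    rw [rank_eq_iff_forall_vecMul] at hrank ⊢
    intro w hw
    rw [vecMul_fromCols_eq_zero_iff] at hw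
    refine hrank w ?_
    rw [vecMul_sub, P.vecMul_closedLoop FS FH hw.2, ← vecMul_sub, ← neg_sub, vecMul_neg, hw.1,
      neg_zero]

end System

end PHDAE

theorem mainTheorem1 {n m : ℕ} (P : PHDAE.System n m)
    {k : ℕ} (S : Matrix (Fin n) (Fin k) ℂ) (hS : PHDAE.IsRightNullspaceBasis P.E S) :
    P.IsStabilizable ↔
      (Matrix.fromCols P.E (Matrix.fromCols ((P.J - P.R) * S) P.B)).rank = n ∧
        ∀ s : ℂ, s.re = 0 → (Matrix.fromCols (P.J - P.R - s • P.E) P.B).rank = n :=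
  ⟨fun h => h.rank_eq hS, fun h => P.isStabilizable_of_rank_eq hS h.1 h.2⟩
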